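/- Let $k=\mathbb F_q$ be a finite field with $q$ elements. A Kronecker module is a finite dimensional representation $M=(V_1,V_2;\alpha,\beta:V_2\to V_1)$ over $k$ of the quiver with two vertices $1,2$ and two arrows $2\to 1$; its dimension vector is $\underline{\dim}M=(\dim V_1,\dim V_2)$. Let $S_1,S_2$ be the simple modules of dimension vectors $(1,0)$ and $(0,1)$, write $cN$ for the direct sum of $c$ copies of $N$, and let $\mathcal K\langle i\rangle$ be the class of Kronecker modules without a direct summand isomorphic to $S_i$. For Kronecker modules $M,X,Y$ let $F^M_{XY}=|\{U\le M : U\cong Y,\ M/U\cong X\}|$ be the Ringel-Hall number. For $a,b\in\mathbb Z$ let $A^M_{a,b}$ be the number of submodules of $M$ of dimension vector $(a,b)$; let $B^M_{a,b}$ (respectively $C^M_{a,b}$) be the sum of $F^M_{XY}$ over all pairs of isomorphism classes $[X],[Y]$ with $\underline{\dim}Y=(a,b)$ and $X,Y\in\mathcal K\langle 1\rangle$ (respectively $X,Y\in\mathcal K\langle 2\rangle$). For $l,a\in\mathbb Z$ let $G^l_a(q)=\frac{(q^a-1)\cdots(q^{a-l+1}-1)}{(q^l-1)\cdots(q-1)}$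 if $l>0$, $G^0_a(q)=1$, and $G^l_a(q)=0$ if $l<0$. For $M=(V_1,V_2;\alpha,\beta)$ let $\neg R_1^+(M)$ be the Kronecker module with space $V_2$ at vertex $1$, space $\ker\big((\alpha,\beta):V_2\oplus V_2\to V_1\big)$ at vertex $2$, and the two coordinate projections as arrows; let $R_1^-\neg(M)$ be the Kronecker module with space $\operatorname{coker}\big(\binom{\alpha}{\beta}:V_2\to V_1\oplus V_1\big)$ at vertex $1$, space $V_1$ at vertex $2$, and as arrows the two maps $V_1\to\operatorname{coker}$ induced by the coordinate inclusions. **Proposition.** Suppose $M\cong sS_1\oplus M'\oplus tS_2$ with $s,t\ge 0$ and $M'\in\mathcal K\langle 1\rangle\cap\mathcal K\langle 2\rangle$. Let $a,b\in\mathbb Z$, $l=a-b$ and $\underline{\dim}M=(m,n)$. Then, all sums below having only finitely many nonzero terms: (a) $$A^M_{a,b}=\sum_{c\in\mathbb Z}G^c_{m-a+c}(q)\,B^{M'\oplus tS_2}_{a-c,\,b}=\sum_{c\in\mathbb Z}G^c_{m-a+c}(q)\,C^{\neg R_1^+(M'\oplus tS_2)}_{a-l,\,b-l+c};$$ (b)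 $$A^M_{a,b}=\sum_{d\in\mathbb Z}G^d_{b+d}(q)\,C^{sS_1\oplus M'}_{a,\,b+d-t}=\sum_{d\in\mathbb Z}G^d_{b+d}(q)\,B^{R_1^-\neg(sS_1\oplus M')}_{a+l-d+t,\,b+l}.$$ -/

import Mathlib

universe u

/-- A Kronecker module over `k`: a finite dimensional representation of the Kronecker quiver
with two arrows `α, β : 2 → 1`, so a pair of linear maps `α, β : V₂ → V₁`. Vertex `1` is the sink. -/
structure KroneckerModule (k : Type u) [Field k] where
  V₁ : Type u
  V₂ : Type u
  [grp₁ : AddCommGroup V₁]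
  [grp₂ : AddCommGroup V₂]
  [mod₁ : Module k V₁]
  [mod₂ : Module k V₂]
  [fin₁ : Module.Finite k V₁]
  [fin₂ : Module.Finite k V₂]
  α : V₂ →ₗ[k] V₁
  β : V₂ →ₗ[k] V₁

namespace KroneckerModule

attribute [instance] grp₁ grp₂ mod₁ mod₂ fin₁ fin₂

variable {k : Type u} [Field k]

/-- An isomorphism of Kronecker modules. -/
structure Iso (M N : KroneckerModule k) where
  e₁ : M.V₁ ≃ₗ[k] N.V₁
  e₂ : M.V₂ ≃ₗ[k] N.V₂
  comm_α : ∀ x, e₁ (M.α x) = N.α (e₂ x)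
  comm_β : ∀ x, e₁ (M.β x) = N.β (e₂ x)

/-- Being isomorphic, as an equivalence relation. -/
instance isoSetoid (k : Type u) [Field k] : Setoid (KroneckerModule k) where
  r M N := Nonempty (Iso M N)
  iseqv :=
    { refl := fun M => ⟨⟨LinearEquiv.refl k _, LinearEquiv.refl k _, fun _ => rfl, fun _ => rfl⟩⟩
      symm := by
        rintro M N ⟨f⟩
        exact ⟨⟨f.e₁.symm, f.e₂.symm,
          fun x => by rw [LinearEquiv.symm_apply_eq, f.comm_α, LinearEquiv.apply_symm_apply],
          fun x => by rw [LinearEquiv.symm_apply_eq, f.comm_β, LinearEquiv.apply_symm_apply]⟩⟩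
      trans := by
        rintro M N P ⟨f⟩ ⟨g⟩
        exact ⟨⟨f.e₁.trans g.e₁, f.e₂.trans g.e₂,
          fun x => by simp [f.comm_α, g.comm_α],
          fun x => by simp [f.comm_β, g.comm_β]⟩⟩ }

/-- The isomorphism classes `[M]` of Kronecker modules. -/
abbrev IsoClass (k : Type u) [Field k] : Type (u + 1) := Quotient (isoSetoid k)

/-- `M` has dimension vector `(a, b)`. -/
def HasDim (M : KroneckerModule k) (a b : ℤ) : Prop :=
  (Module.finrank k M.V₁ : ℤ) = a ∧ (Module.finrank k M.V₂ : ℤ) = b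

/-- The simple module `S₁`, of dimension vector `(1, 0)`. -/
def simple₁ (k : Type u) [Field k] : KroneckerModule k where
  V₁ := k
  V₂ := PUnit.{u + 1}
  α := 0
  β := 0

/-- The simple module `S₂`, of dimension vector `(0, 1)`. -/
def simple₂ (k : Type u) [Field k] : KroneckerModule k where
  V₁ := PUnit.{u + 1}
  V₂ := k
  α := 0
  β := 0

/-- The direct sum `M ⊕ N`. -/
def sum (M N : KroneckerModule k) : KroneckerModule k where
  V₁ := M.V₁ × N.V₁
  V₂ := M.V₂ × N.V₂
  α := M.α.prodMap N.α
  β := M.β.prodMap N.β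

/-- The direct sum `cM = M ⊕ ⋯ ⊕ M` of `c` copies of `M`. -/
def copies (c : ℕ) (M : KroneckerModule k) : KroneckerModule k where
  V₁ := Fin c → M.V₁
  V₂ := Fin c → M.V₂
  α := LinearMap.pi fun i => M.α ∘ₗ LinearMap.proj i
  β := LinearMap.pi fun i => M.β ∘ₗ LinearMap.proj i

/-- `S` is, up to isomorphism, a direct summand of `M`. -/
def IsSummand (S M : KroneckerModule k) : Prop :=
  ∃ N : KroneckerModule k, Nonempty (Iso M (S.sum N))

/-- `M` belongs to `mod-kK⟨1⟩`: it does not contain `S₁` as a direct summand. -/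
def NoS₁ (M : KroneckerModule k) : Prop := ¬ IsSummand (simple₁ k) M

/-- `M` belongs to `mod-kK⟨2⟩`: it does not contain `S₂` as a direct summand. -/
def NoS₂ (M : KroneckerModule k) : Prop := ¬ IsSummand (simple₂ k) M

/-- A submodule of a Kronecker module. -/
@[ext]
structure Sub (M : KroneckerModule k) where
  U₁ : Submodule k M.V₁
  U₂ : Submodule k M.V₂
  map_α : ∀ x ∈ U₂, M.α x ∈ U₁
  map_β : ∀ x ∈ U₂, M.β x ∈ U₁

/-- A submodule as a Kronecker module in its own right. -/
def Sub.toModule {M : KroneckerModule k} (U : Sub M) : KroneckerModule k where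
  V₁ := U.U₁
  V₂ := U.U₂
  α := M.α.restrict U.map_α
  β := M.β.restrict U.map_β

/-- The quotient module `M / U`. -/
def Sub.quotient {M : KroneckerModule k} (U : Sub M) : KroneckerModule k where
  V₁ := M.V₁ ⧸ U.U₁
  V₂ := M.V₂ ⧸ U.U₂
  α := U.U₂.mapQ U.U₁ M.α U.map_α
  β := U.U₂.mapQ U.U₁ M.β U.map_β

/-- The Ringel-Hall number `F^M_{XY}`: the number of submodules `U` of `M` with
`U ≅ Y` and `M / U ≅ X`. -/
noncomputable def hall (M X Y : KroneckerModule k) : ℕ :=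
  Nat.card {U : Sub M // Nonempty (Iso U.toModule Y) ∧ Nonempty (Iso U.quotient X)}

/-- `A^M_{a,b}`: the cardinality of the Grassmannian of submodules of `M` with dimension vector
`(a, b)`. -/
noncomputable def countA (M : KroneckerModule k) (a b : ℤ) : ℕ :=
  Nat.card {U : Sub M // U.toModule.HasDim a b}

/-- The sum of the Ringel-Hall numbers `F^M_{XY}` over all pairs of isomorphism classes `[X], [Y]`
with `dim Y = (a, b)` such that `X` and `Y` both satisfy `P`. -/
noncomputable def hallSum (P : KroneckerModule k → Prop) (M : KroneckerModule k) (a b : ℤ) : ℕ :=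
  ∑ᶠ (x : IsoClass k) (y : IsoClass k)
    (_ : y.out.HasDim a b ∧ P x.out ∧ P y.out), hall M x.out y.out

/-- `B^M_{a,b}`: the sum of `F^M_{XY}` over `[X], [Y]` with `dim Y = (a, b)` and `X, Y` without
direct summand `S₁`. -/
noncomputable def countB (M : KroneckerModule k) (a b : ℤ) : ℕ := hallSum NoS₁ M a b

/-- `C^M_{a,b}`: the sum of `F^M_{XY}` over `[X], [Y]` with `dim Y = (a, b)` and `X, Y` without
direct summand `S₂`. -/
noncomputable def countC (M : KroneckerModule k) (a b : ℤ) : ℕ := hallSum NoS₂ M a b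

/-- The module `¬R₁⁺(M)`. The reflection functor `R₁⁺` at the sink `1` replaces `V₁` by the kernel
of `(α, β) : V₂ ⊕ V₂ → V₁`, the new arrows (which start at vertex `1`) being the two projections of
this kernel to `V₂`. The relabeling `¬` exchanges the names of the two vertices, so that `V₂` comes
to vertex `1` and the kernel to vertex `2`. -/
def reflPlus (M : KroneckerModule k) : KroneckerModule k where
  V₁ := M.V₂
  V₂ := LinearMap.ker (M.α.coprod M.β)
  α := LinearMap.fst k M.V₂ M.V₂ ∘ₗ (LinearMap.ker (M.α.coprod M.β)).subtype
  β := LinearMap.snd k M.V₂ M.V₂ ∘ₗ (LinearMap.ker (M.α.coprod M.β)).subtype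

/-- The module `R₁⁻¬(M)`. The relabeling `¬` exchanges the names of the two vertices, so that `V₂`
comes to vertex `1`, now a source, and `V₁` to vertex `2`. The reflection functor `R₁⁻` at the
source `1` then replaces `V₂` by the cokernel of `(α, β) : V₂ → V₁ ⊕ V₁`, the new arrows being the
two maps from `V₁` to this cokernel. -/
def reflMinus (M : KroneckerModule k) : KroneckerModule k where
  V₁ := (M.V₁ × M.V₁) ⧸ LinearMap.range (M.α.prod M.β)
  V₂ := M.V₁
  α := (LinearMap.range (M.α.prod M.β)).mkQ ∘ₗ LinearMap.inl k M.V₁ M.V₁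
  β := (LinearMap.range (M.α.prod M.β)).mkQ ∘ₗ LinearMap.inr k M.V₁ M.V₁

end KroneckerModule

/-- The Gaussian coefficient `G^l_a(q)` for integers `l, a`: for `l > 0` it is
`((q^a - 1) ⋯ (q^(a-l+1) - 1)) / ((q^l - 1) ⋯ (q - 1))`, and it is `1` for `l = 0` (empty products)
and `0` for `l < 0`. -/
def gaussCoeff (q : ℚ) (l a : ℤ) : ℚ :=
  if l < 0 then 0
  else (∏ i ∈ Finset.range l.toNat, (q ^ (a - (i : ℤ)) - 1)) /
    ∏ i ∈ Finset.range l.toNat, (q ^ (i + 1) - 1)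

/-! A submodule of `M` is a pair `(U₁, U₂)` with `M.gen U₂ ≤ U₁`, or equivalently `U₂ ≤ M.cogen U₁`.
If `U₂` is fixed, the possible `U₁` correspond to subspaces of `V₁ / gen U₂`, so their number is a
Gaussian coefficient depending only on `dim gen U₂`. Sorting the `U₂` by `c = a - dim gen U₂` gives
the sum in (a) (`countA_eq_finsum_gen`). Fixing `U₁` and sorting by `d = dim cogen U₁ - b` gives the
sum in (b) (`countA_eq_finsum_cogen`).

The remaining factors are Hall sums. A submodule has no summand `S₁` exactly when `U₁ = gen U₂`, and
quotients of a module without `S₁` inherit this property. Hence `countB` counts subspaces `U₂` by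
`dim gen U₂` (`countB_eq_card`), and dually `countC` counts subspaces `U₁` by `dim cogen U₁`
(`countC_eq_card`). Copies of `S₁` do not affect `gen`, and `t` copies of `S₂` enlarge every `cogen`
by `t` dimensions.

The reflections keep one of the two spaces and turn `gen` into `cogen` or back. Rank-nullity on `U ⊕
U` shows that the two dimensions add up to `2 dim U` (`finrank_cogen_reflPlus`,
`finrank_gen_reflMinus`), so the same subspaces are counted before and after. -/

/-! ### Gaussian coefficients and counting subspaces -/

open Module in
theorem card_finrank_submodule_mul {k : Type*} {V : Type*} [Field k] [Finite k] [AddCommGroup V]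
    [Module k V] [Module.Finite k V] {c : ℕ} (hc : c ≤ finrank k V) :
    Nat.card {U : Submodule k V // finrank k U = c} *
        ∏ i ∈ Finset.range c, (Nat.card k ^ c - Nat.card k ^ i) =
      ∏ i ∈ Finset.range c, (Nat.card k ^ finrank k V - Nat.card k ^ i) := by
  classical
  have : Finite V := Module.finite_of_finite k
  have := Fintype.ofFinite k
  have := Fintype.ofFinite {U : Submodule k V // finrank k U = c}
  -- Double counting: an independent `c`-tuple in `V` is a `c`-dimensional subspace, its span,
  -- together with an ordered basis of it.
  have key : {s : Fin c → V // LinearIndependent k s} ≃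
      Σ U : {U : Submodule k V // finrank k U = c},
        {s : Fin c → U.1 // LinearIndependent k s} := by
    have hspan {U : Submodule k V} (hU : finrank k U = c) {s : Fin c → U}
        (hs : LinearIndependent k s) : Submodule.span k (Set.range fun i => (s i : V)) = U := by
      apply Submodule.eq_of_le_of_finrank_eq
      · rw [Submodule.span_le]
        rintro _ ⟨i, rfl⟩
        exact (s i).2
      · have hs' : LinearIndependent k fun i => (s i : V) :=
          hs.map' (Submodule.subtype _) (Submodule.ker_subtype _)
        rw [finrank_span_eq_card hs', Fintype.card_fin, hU]
    refine (Equiv.ofBijective (fun s => ⟨fun i => s.2.1 i,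
        s.2.2.map' (Submodule.subtype _) (Submodule.ker_subtype _)⟩) ⟨?_, ?_⟩).symm
    · rintro ⟨⟨U, hU⟩, ⟨s, hs⟩⟩ ⟨⟨W, hW⟩, ⟨r, hr⟩⟩ h
      have h : (fun i => (s i : V)) = fun i => (r i : V) := congrArg Subtype.val h
      obtain rfl : U = W := by rw [← hspan hU hs, ← hspan hW hr, h]
      obtain rfl : s = r := funext fun i => Subtype.ext (congrFun h i)
      rfl
    · intro s
      exact ⟨⟨⟨Submodule.span k (Set.range s.1), by rw [finrank_span_eq_card s.2, Fintype.card_fin]⟩,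
        ⟨fun i => ⟨s.1 i, Submodule.subset_span ⟨i, rfl⟩⟩,
          LinearIndependent.of_comp (Submodule.subtype _) s.2⟩⟩, rfl⟩
  have h1 := Nat.card_congr key
  rw [card_linearIndependent hc, Nat.card_sigma, Fin.prod_univ_eq_prod_range
    (fun i => Fintype.card k ^ finrank k V - Fintype.card k ^ i)] at h1
  rw [Nat.card_eq_fintype_card (α := k), h1, Finset.sum_congr rfl (fun U _ => by
    rw [card_linearIndependent U.2.ge, U.2, Fin.prod_univ_eq_prod_range
      (fun i => Fintype.card k ^ c - Fintype.card k ^ i)])]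
  simp

theorem gaussCoeff_natCast_of_lt (q : ℚ) {c n : ℕ} (h : n < c) : gaussCoeff q c n = 0 := by
  -- The factor `i = n` is `q ^ 0 - 1`.
  have : ∏ i ∈ Finset.range c, (q ^ ((n : ℤ) - (i : ℤ)) - 1) = 0 :=
    Finset.prod_eq_zero (Finset.mem_range.2 h) (by simp)
  simp [gaussCoeff, this]

/-- The factorial form makes the symmetry between `c` and `d` visible. -/
theorem gaussCoeff_natCast_add (q : ℚ) (hq : 1 < q) (c d : ℕ) :
    gaussCoeff q c (c + d : ℕ) = (∏ i ∈ Finset.range (c + d), (q ^ (i + 1) - 1)) /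
      ((∏ i ∈ Finset.range c, (q ^ (i + 1) - 1)) * ∏ i ∈ Finset.range d, (q ^ (i + 1) - 1)) := by
  have hpos (n : ℕ) : ∏ i ∈ Finset.range n, (q ^ (i + 1) - 1) ≠ 0 :=
    Finset.prod_ne_zero_iff.2 fun i _ => (sub_pos.2 (one_lt_pow₀ hq i.succ_ne_zero)).ne'
  have h : ∏ i ∈ Finset.range c, (q ^ (((c + d : ℕ) : ℤ) - (i : ℤ)) - 1) =
      ∏ i ∈ Finset.range c, (q ^ (d + i + 1) - 1) := by
    rw [← Finset.prod_range_reflect]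
    refine Finset.prod_congr rfl fun i hi => ?_
    have := Finset.mem_range.1 hi
    rw [← zpow_natCast]
    congr 2
    lia
  rw [gaussCoeff, if_neg (by lia), Int.toNat_natCast, h, add_comm c d, Finset.prod_range_add,
    mul_comm (∏ i ∈ Finset.range c, (q ^ (i + 1) - 1)), mul_div_mul_left _ _ (hpos d)]

/-- Outside `0 ≤ b ≤ n` both sides vanish, one for a negative lower index and the other for a zero
factor; inside, the factorial form is symmetric. -/
theorem gaussCoeff_sub_self (q : ℚ) (hq : 1 < q) (b : ℤ) (n : ℕ) :
    gaussCoeff q (n - b) n = gaussCoeff q b n := by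
  rcases lt_or_ge b 0 with hb | hb
  · obtain ⟨c, hc⟩ := Int.eq_ofNat_of_zero_le (a := n - b) (by lia)
    rw [hc, gaussCoeff_natCast_of_lt q (by lia), gaussCoeff, if_pos hb]
  · lift b to ℕ using hb
    rcases lt_or_ge n b with h | h
    · rw [gaussCoeff_natCast_of_lt q h, gaussCoeff, if_pos (by lia)]
    · obtain ⟨d, rfl⟩ := Nat.exists_eq_add_of_le h
      rw [gaussCoeff_natCast_add q hq, show ((b + d : ℕ) : ℤ) - b = d by lia, add_comm b d,
        gaussCoeff_natCast_add q hq, mul_comm (∏ i ∈ Finset.range d, _)]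

open Module in
theorem finrank_comap_of_surjective {k V V' : Type*} [Field k] [AddCommGroup V] [Module k V]
    [Module.Finite k V] [AddCommGroup V'] [Module k V'] (f : V →ₗ[k] V')
    (hf : Function.Surjective f) (U : Submodule k V') :
    finrank k (U.comap f) = finrank k U + finrank k (LinearMap.ker f) := by
  have h := LinearMap.finrank_range_add_finrank_ker (f.domRestrict (U.comap f))
  rw [LinearMap.range_domRestrict, Submodule.map_comap_eq_of_surjective hf,
    LinearMap.ker_domRestrict,
    (Submodule.comapSubtypeEquivOfLe (LinearMap.ker_le_comap (p := U) f)).finrank_eq] at h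
  exact h.symm

section Grassmannian

open Module

variable {k : Type*} {V : Type*} [Field k] [Finite k] [AddCommGroup V] [Module k V]
  [Module.Finite k V]

/-- The Gaussian coefficient counts the subspaces of a given dimension. -/
theorem card_finrank_submodule (c : ℤ) :
    (Nat.card {U : Submodule k V // (finrank k U : ℤ) = c} : ℚ) =
      gaussCoeff (Nat.card k) c (finrank k V) := by
  rcases lt_or_ge c 0 with hc | hc
  · have : IsEmpty {U : Submodule k V // (finrank k U : ℤ) = c} := ⟨fun U => by have := U.2; lia⟩
    simp [gaussCoeff, hc]
  lift c to ℕ using hc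
  simp only [Nat.cast_inj]
  rcases lt_or_ge (finrank k V) c with h | h
  · have : IsEmpty {U : Submodule k V // finrank k U = c} :=
      ⟨fun U => by have := U.2; have := Submodule.finrank_le U.1; lia⟩
    simp [gaussCoeff_natCast_of_lt _ h]
  have hq : 1 < Nat.card k := Finite.one_lt_card
  have hq' : (1 : ℚ) < Nat.card k := by exact_mod_cast hq
  -- Extracting `q ^ i` from each factor leaves the same power of `q` on both sides of the double
  -- count. Since `i < c ≤ n`, the subtraction in `ℕ` is not truncated.
  have hcast (n : ℕ) (hn : c ≤ n) :
      ((∏ i ∈ Finset.range c, (Nat.card k ^ n - Nat.card k ^ i) : ℕ) : ℚ) =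
        (∏ i ∈ Finset.range c, (Nat.card k : ℚ) ^ i) *
          ∏ i ∈ Finset.range c, ((Nat.card k : ℚ) ^ ((n : ℤ) - (i : ℤ)) - 1) := by
    rw [Nat.cast_prod, ← Finset.prod_mul_distrib]
    refine Finset.prod_congr rfl fun i hi => ?_
    have hi := Finset.mem_range.1 hi
    rw [Nat.cast_sub (Nat.pow_le_pow_right hq.le (by lia)), mul_sub, mul_one,
      ← zpow_natCast _ i, ← zpow_add₀ (by positivity)]
    simp
  have hden : ∏ i ∈ Finset.range c, ((Nat.card k : ℚ) ^ ((c : ℤ) - (i : ℤ)) - 1) =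
      ∏ i ∈ Finset.range c, ((Nat.card k : ℚ) ^ (i + 1) - 1) := by
    rw [← Finset.prod_range_reflect]
    refine Finset.prod_congr rfl fun i hi => ?_
    have := Finset.mem_range.1 hi
    rw [← zpow_natCast]
    congr 2
    lia
  have key := congrArg (Nat.cast (R := ℚ)) (card_finrank_submodule_mul (k := k) (V := V) h)
  rw [Nat.cast_mul, hcast _ le_rfl, hcast _ h, hden] at key
  have h0 : ∏ i ∈ Finset.range c, (Nat.card k : ℚ) ^ i ≠ 0 :=
    Finset.prod_ne_zero_iff.2 fun i _ => by positivity
  have hpos : ∏ i ∈ Finset.range c, ((Nat.card k : ℚ) ^ (i + 1) - 1) ≠ 0 :=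
    Finset.prod_ne_zero_iff.2 fun i _ => (sub_pos.2 (one_lt_pow₀ hq' i.succ_ne_zero)).ne'
  rw [gaussCoeff, if_neg (by lia), Int.toNat_natCast, eq_div_iff hpos]
  apply mul_left_cancel₀ h0
  rw [← key]
  ring

/-- The correspondence between subspaces containing `W` and subspaces of `V ⧸ W` lowers dimensions
by `dim W`. -/
theorem card_finrank_submodule_ge (W : Submodule k V) (a : ℤ) :
    (Nat.card {U : Submodule k V // W ≤ U ∧ (finrank k U : ℤ) = a} : ℚ) =
      gaussCoeff (Nat.card k) (a - finrank k W) (finrank k V - finrank k W) := by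
  have hW : ((finrank k (V ⧸ W) : ℕ) : ℤ) = finrank k V - finrank k W := by
    have := W.finrank_quotient_add_finrank
    lia
  rw [← hW, ← card_finrank_submodule]
  congr 1
  have hdim (U : Submodule k (V ⧸ W)) : finrank k (U.comap W.mkQ) = finrank k U + finrank k W := by
    rw [finrank_comap_of_surjective _ W.mkQ_surjective, W.ker_mkQ]
  exact Nat.card_congr
    { toFun := fun U => ⟨U.1.map W.mkQ, by
        have := hdim (U.1.map W.mkQ)
        rw [Submodule.comap_map_mkQ, sup_eq_right.2 U.2.1] at this
        have := U.2.2
        lia⟩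
      invFun := fun U => ⟨U.1.comap W.mkQ, W.le_comap_mkQ U.1, by
        have := hdim U.1
        have := U.2
        lia⟩
      left_inv := fun U => Subtype.ext
        ((Submodule.comap_map_mkQ W U.1).trans (sup_eq_right.2 U.2.1))
      right_inv := fun U => Subtype.ext
        (Submodule.map_comap_eq_of_surjective W.mkQ_surjective U.1) }

theorem card_finrank_submodule_le (P : Submodule k V) (b : ℤ) :
    (Nat.card {U : Submodule k V // U ≤ P ∧ (finrank k U : ℤ) = b} : ℚ) =
      gaussCoeff (Nat.card k) b (finrank k P) := by
  rw [← card_finrank_submodule]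
  congr 1
  have hmap {U : Submodule k V} (hU : U ≤ P) : (U.comap P.subtype).map P.subtype = U := by
    rw [Submodule.map_comap_subtype, inf_eq_right.2 hU]
  have hdim (U : Submodule k P) : finrank k (U.map P.subtype) = finrank k U :=
    Submodule.finrank_map_subtype_eq P U
  exact Nat.card_congr
    { toFun := fun U => ⟨U.1.comap P.subtype, by rw [← hdim, hmap U.2.1, U.2.2]⟩
      invFun := fun U => ⟨U.1.map P.subtype, Submodule.map_subtype_le P U.1, by rw [hdim, U.2]⟩
      left_inv := fun U => Subtype.ext (hmap U.2.1)
      right_inv := fun U => Subtype.ext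
        (Submodule.comap_map_eq_of_injective P.injective_subtype U.1) }

end Grassmannian

/-! ### Sums grouped by fibres -/

/-- Only values taken by `f` contribute. Finiteness of the support is recorded because `∑ᶠ` is `0`
by default on an infinite support. -/
theorem finsum_mul_card_fiber {T ι : Type*} [Finite T] (f : T → ι) (G : ι → ℚ) :
    (Function.support fun i => G i * (Nat.card {x // f x = i} : ℚ)).Finite ∧
      ∑ᶠ x, G (f x) = ∑ᶠ i, G i * (Nat.card {x // f x = i} : ℚ) := by
  classical
  have := Fintype.ofFinite T
  have hs : (Function.support fun i => G i * (Nat.card {x // f x = i} : ℚ)) ⊆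
      (Finset.univ.image f : Finset ι) := by
    intro i hi
    rw [Function.mem_support] at hi
    have : Nat.card {x // f x = i} ≠ 0 := fun h => hi (by rw [h, Nat.cast_zero, mul_zero])
    obtain ⟨⟨x, hx⟩⟩ := (Nat.card_ne_zero.1 this).1
    simpa using ⟨x, hx⟩
  refine ⟨(Finset.finite_toSet _).subset hs, ?_⟩
  rw [finsum_eq_sum_of_support_subset _ hs, finsum_eq_sum_of_fintype, Finset.sum_comp]
  refine Finset.sum_congr rfl fun i _ => ?_
  rw [nsmul_eq_mul, mul_comm, Nat.card_eq_fintype_card, Fintype.card_subtype]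

theorem finsum_card_fiber {T ι : Type*} [Finite T] (f : T → ι) :
    ∑ᶠ i, Nat.card {x // f x = i} = Nat.card T := by
  classical
  have := Fintype.ofFinite T
  have hs : (Function.support fun i => Nat.card {x // f x = i}) ⊆
      (Finset.univ.image f : Finset ι) := by
    intro i hi
    obtain ⟨⟨x, hx⟩⟩ := (Nat.card_ne_zero.1 hi).1
    simpa using ⟨x, hx⟩
  rw [finsum_eq_sum_of_support_subset _ hs, Nat.card_eq_fintype_card, ← Finset.card_univ,
    Finset.card_eq_sum_card_image f]
  refine Finset.sum_congr rfl fun i _ => ?_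
  rw [Nat.card_eq_fintype_card, Fintype.card_subtype]

/-! ### Generated and cogenerated subspaces, and simple summands -/

open Module

namespace KroneckerModule

variable {k : Type u} [Field k]

/-- The subspace of `V₁` generated by a subspace of `V₂`. -/
def gen (M : KroneckerModule k) (U : Submodule k M.V₂) : Submodule k M.V₁ :=
  U.map M.α ⊔ U.map M.β

/-- The largest subspace of `V₂` that both arrows send into a given subspace of `V₁`. -/
def cogen (M : KroneckerModule k) (U : Submodule k M.V₁) : Submodule k M.V₂ :=
  U.comap M.α ⊓ U.comap M.β

/-- With `le_cogen_iff`, this is the adjunction between `gen` and `cogen`: either inequality says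
that `(W, U)` is a submodule. -/
theorem gen_le_iff {M : KroneckerModule k} {U : Submodule k M.V₂} {W : Submodule k M.V₁} :
    M.gen U ≤ W ↔ (∀ x ∈ U, M.α x ∈ W) ∧ ∀ x ∈ U, M.β x ∈ W := by
  rw [gen, sup_le_iff, Submodule.map_le_iff_le_comap, Submodule.map_le_iff_le_comap]
  rfl

theorem le_cogen_iff {M : KroneckerModule k} {U : Submodule k M.V₂} {W : Submodule k M.V₁} :
    U ≤ M.cogen W ↔ (∀ x ∈ U, M.α x ∈ W) ∧ ∀ x ∈ U, M.β x ∈ W :=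
  le_inf_iff

theorem mem_cogen {M : KroneckerModule k} {W : Submodule k M.V₁} {x : M.V₂} :
    x ∈ M.cogen W ↔ M.α x ∈ W ∧ M.β x ∈ W := Iff.rfl

theorem α_mem_gen {M : KroneckerModule k} {U : Submodule k M.V₂} {x : M.V₂} (hx : x ∈ U) :
    M.α x ∈ M.gen U := (gen_le_iff.1 le_rfl).1 x hx

theorem β_mem_gen {M : KroneckerModule k} {U : Submodule k M.V₂} {x : M.V₂} (hx : x ∈ U) :
    M.β x ∈ M.gen U := (gen_le_iff.1 le_rfl).2 x hx

/-- A vector and a functional taking the value `1` on it split off a copy of the ground field. -/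
def splitEquiv {V : Type*} [AddCommGroup V] [Module k V] (f : V →ₗ[k] k) (v : V) (h : f v = 1) :
    V ≃ₗ[k] k × LinearMap.ker f where
  toFun y := (f y, ⟨y - f y • v, by simp [h]⟩)
  invFun z := z.1 • v + z.2
  map_add' x y := by
    ext
    · simp
    · simp only [map_add, Prod.snd_add, Submodule.coe_add]; module
  map_smul' c x := by
    ext
    · simp
    · simp only [map_smul, Prod.smul_snd, Submodule.coe_smul, RingHom.id_apply, smul_eq_mul]; module
  left_inv y := by simp
  right_inv z := by
    have := z.2.2
    rw [LinearMap.mem_ker] at this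
    ext <;> simp [h, this]

theorem exists_dual_eq_one {V : Type*} [AddCommGroup V] [Module k V] {p : Submodule k V} {v : V}
    (hv : v ∉ p) : ∃ f : V →ₗ[k] k, f v = 1 ∧ p ≤ LinearMap.ker f := by
  obtain ⟨f, hf, hp⟩ := Submodule.exists_le_ker_of_notMem hv
  exact ⟨(f v)⁻¹ • f, by simp [hf], fun x hx => by simp [LinearMap.mem_ker.1 (hp hx)]⟩

/-- If `v` lies outside the span of the images of the arrows, a functional `f` that kills this span
with `f v = 1` splits `V₁` as `k v ⊕ ker f`, and both arrows land in `ker f`. Conversely, the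
projection onto a summand `S₁` is nonzero on `V₁` but kills `gen ⊤`. -/
theorem noS₁_iff (M : KroneckerModule k) : M.NoS₁ ↔ M.gen ⊤ = ⊤ := by
  rw [NoS₁, not_iff_comm]
  constructor
  · intro h
    obtain ⟨v, -, hv⟩ := SetLike.exists_of_lt (lt_top_iff_ne_top.2 h)
    obtain ⟨f, hfv, hf⟩ := exists_dual_eq_one hv
    have hα (x : M.V₂) : f (M.α x) = 0 := hf (α_mem_gen trivial)
    have hβ (x : M.V₂) : f (M.β x) = 0 := hf (β_mem_gen trivial)
    refine ⟨{ V₁ := LinearMap.ker f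
              V₂ := M.V₂
              α := M.α.codRestrict _ hα
              β := M.β.codRestrict _ hβ },
      ⟨{ e₁ := splitEquiv f v hfv
         e₂ := LinearEquiv.symm (LinearEquiv.uniqueProd (R := k) (M := M.V₂) (M₂ := PUnit.{u + 1}))
         comm_α := fun x => ?_
         comm_β := fun x => ?_ }⟩⟩
    · refine Prod.ext (hα x) (Subtype.ext ?_)
      change M.α x - f (M.α x) • v = M.α x
      rw [hα, zero_smul, sub_zero]
    · refine Prod.ext (hβ x) (Subtype.ext ?_)
      change M.β x - f (M.β x) • v = M.β x
      rw [hβ, zero_smul, sub_zero]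
  · rintro ⟨N, ⟨e⟩⟩ h
    have hle : M.gen ⊤ ≤ (LinearMap.ker (LinearMap.fst k k N.V₁)).comap e.e₁.toLinearMap :=
      gen_le_iff.2 ⟨fun x _ => congrArg Prod.fst (e.comm_α x),
        fun x _ => congrArg Prod.fst (e.comm_β x)⟩
    obtain ⟨x, hx⟩ := e.e₁.surjective ((1, 0) : k × N.V₁)
    have h1 : (e.e₁ x).1 = (0 : k) := hle (x := x) (h ▸ trivial)
    rw [hx] at h1
    exact one_ne_zero (α := k) h1

/-- A nonzero vector killed by both arrows spans a copy of `S₂`. Any complement of its line in `V₂`,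
taken with all of `V₁`, is a complementary submodule. -/
theorem noS₂_iff (M : KroneckerModule k) : M.NoS₂ ↔ M.cogen ⊥ = ⊥ := by
  rw [NoS₂, not_iff_comm]
  constructor
  · intro h
    obtain ⟨v, hv, hv0⟩ := (Submodule.ne_bot_iff _).1 h
    obtain ⟨f, hfv, -⟩ := exists_dual_eq_one (p := (⊥ : Submodule k M.V₂)) (v := v) (by simpa using hv0)
    have hα : M.α v = 0 := hv.1
    have hβ : M.β v = 0 := hv.2
    refine ⟨{ V₁ := M.V₁
              V₂ := LinearMap.ker f
              α := M.α.domRestrict _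
              β := M.β.domRestrict _ },
      ⟨{ e₁ := LinearEquiv.symm (LinearEquiv.uniqueProd (R := k) (M := M.V₁) (M₂ := PUnit.{u + 1}))
         e₂ := splitEquiv f v hfv
         comm_α := fun x => ?_
         comm_β := fun x => ?_ }⟩⟩
    · refine Prod.ext rfl ?_
      change M.α x = M.α (x - f x • v)
      rw [map_sub, map_smul, hα, smul_zero, sub_zero]
    · refine Prod.ext rfl ?_
      change M.β x = M.β (x - f x • v)
      rw [map_sub, map_smul, hβ, smul_zero, sub_zero]
  · rintro ⟨N, ⟨e⟩⟩ h
    obtain ⟨x, hx⟩ := e.e₂.surjective ((1, 0) : k × N.V₂)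
    have h1 : x ∈ M.cogen ⊥ := by
      refine mem_cogen.2 ⟨?_, ?_⟩
      · rw [Submodule.mem_bot, ← e.e₁.map_eq_zero_iff, e.comm_α, hx]
        exact Prod.ext rfl (map_zero N.α)
      · rw [Submodule.mem_bot, ← e.e₁.map_eq_zero_iff, e.comm_β, hx]
        exact Prod.ext rfl (map_zero N.β)
    rw [h, Submodule.mem_bot] at h1
    rw [h1, map_zero] at hx
    exact zero_ne_one (α := k) (congrArg Prod.fst hx)

theorem NoS₁.of_equiv {M N : KroneckerModule k} (h : M ≈ N) (hM : M.NoS₁) : N.NoS₁ := by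
  rintro ⟨P, hP⟩
  exact hM ⟨P, Setoid.trans h hP⟩

theorem NoS₂.of_equiv {M N : KroneckerModule k} (h : M ≈ N) (hM : M.NoS₂) : N.NoS₂ := by
  rintro ⟨P, hP⟩
  exact hM ⟨P, Setoid.trans h hP⟩

theorem HasDim.of_equiv {M N : KroneckerModule k} {a b : ℤ} (h : M ≈ N) (hM : M.HasDim a b) :
    N.HasDim a b := by
  obtain ⟨e⟩ := h
  exact ⟨e.e₁.finrank_eq ▸ hM.1, e.e₂.finrank_eq ▸ hM.2⟩

/-- This is `noS₁_iff` read inside `M`; it makes `U₁` a function of `U₂`. -/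
theorem noS₁_toModule_iff {M : KroneckerModule k} (U : Sub M) :
    U.toModule.NoS₁ ↔ M.gen U.U₂ = U.U₁ := by
  rw [noS₁_iff]
  constructor
  · intro h
    have hle : U.toModule.gen ⊤ ≤ (M.gen U.U₂).comap U.U₁.subtype :=
      gen_le_iff.2 ⟨fun x _ => α_mem_gen x.2, fun x _ => β_mem_gen x.2⟩
    rw [h] at hle
    exact le_antisymm (gen_le_iff.2 ⟨U.map_α, U.map_β⟩) fun y hy => hle (x := ⟨y, hy⟩) trivial
  · intro h
    have hle : M.gen U.U₂ ≤ (U.toModule.gen ⊤).map U.U₁.subtype :=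
      gen_le_iff.2
        ⟨fun x hx => ⟨_, α_mem_gen (M := U.toModule) (x := ⟨x, hx⟩) trivial, rfl⟩,
        fun x hx => ⟨_, β_mem_gen (M := U.toModule) (x := ⟨x, hx⟩) trivial, rfl⟩⟩
    refine eq_top_iff.2 fun y _ => ?_
    have hy : y.1 ∈ M.gen U.U₂ := by
      rw [h]
      exact y.2
    obtain ⟨z, hz, hzy⟩ := hle hy
    obtain rfl : z = y := Subtype.ext hzy
    exact hz

theorem noS₂_quotient_iff {M : KroneckerModule k} (U : Sub M) :
    U.quotient.NoS₂ ↔ M.cogen U.U₁ = U.U₂ := by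
  have h (x : M.V₂) : U.U₂.mkQ x ∈ U.quotient.cogen ⊥ ↔ x ∈ M.cogen U.U₁ :=
    and_congr (Submodule.Quotient.mk_eq_zero U.U₁) (Submodule.Quotient.mk_eq_zero U.U₁)
  rw [noS₂_iff]
  constructor
  · intro h0
    refine le_antisymm (fun x hx => ?_) (le_cogen_iff.2 ⟨U.map_α, U.map_β⟩)
    have h1 := (h x).2 hx
    rw [h0] at h1
    exact (Submodule.Quotient.mk_eq_zero U.U₂).1 h1
  · intro h0
    refine eq_bot_iff.2 fun y hy => ?_
    obtain ⟨x, rfl⟩ := U.U₂.mkQ_surjective y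
    exact (Submodule.Quotient.mk_eq_zero U.U₂).2 (h0 ▸ (h x).1 hy)

/-- Being generated by `V₂` passes to quotients, so the condition on `X` in `countB` is automatic.
-/
theorem NoS₁.quotient {M : KroneckerModule k} (h : M.NoS₁) (U : Sub M) : U.quotient.NoS₁ := by
  rw [noS₁_iff] at h ⊢
  have hle : M.gen ⊤ ≤ (U.quotient.gen ⊤).comap U.U₁.mkQ :=
    gen_le_iff.2 ⟨fun x _ => α_mem_gen (M := U.quotient) (x := U.U₂.mkQ x) trivial,
      fun x _ => β_mem_gen (M := U.quotient) (x := U.U₂.mkQ x) trivial⟩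
  rw [h] at hle
  refine eq_top_iff.2 fun y _ => ?_
  obtain ⟨x, rfl⟩ := U.U₁.mkQ_surjective y
  exact hle (x := x) trivial

theorem NoS₂.toModule {M : KroneckerModule k} (h : M.NoS₂) (U : Sub M) : U.toModule.NoS₂ := by
  rw [noS₂_iff] at h ⊢
  refine eq_bot_iff.2 fun x hx => ?_
  have hx' : x.1 ∈ M.cogen ⊥ := ⟨congrArg Subtype.val hx.1, congrArg Subtype.val hx.2⟩
  rw [h] at hx'
  exact Subtype.ext hx'

/-! ### Hall sums and Grassmannians as counts of subspaces -/

section Finite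

variable [Finite k]

instance finite_submodule_V₁ (M : KroneckerModule k) : Finite (Submodule k M.V₁) := by
  have : Finite M.V₁ := Module.finite_of_finite k
  infer_instance

instance finite_submodule_V₂ (M : KroneckerModule k) : Finite (Submodule k M.V₂) := by
  have : Finite M.V₂ := Module.finite_of_finite k
  infer_instance

instance finite_sub (M : KroneckerModule k) : Finite (Sub M) :=
  Finite.of_injective (fun U => (U.U₁, U.U₂)) fun _ _ h =>
    Sub.ext (congrArg Prod.fst h) (congrArg Prod.snd h)

/-- Each submodule `U` contributes to exactly one pair of classes, those of `M / U` and `U`.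
Invariance of `P` allows passage between chosen representatives and actual modules. -/
theorem hallSum_eq_card {P : KroneckerModule k → Prop}
    (hP : ∀ {M N : KroneckerModule k}, M ≈ N → P M → P N) (M : KroneckerModule k) (a b : ℤ) :
    hallSum P M a b =
      Nat.card {U : Sub M // U.toModule.HasDim a b ∧ P U.quotient ∧ P U.toModule} := by
  rw [hallSum, ← finsum_card_fiber (fun U => (⟦U.1.quotient⟧ : IsoClass k))]
  refine finsum_congr fun x => ?_
  rw [← finsum_card_fiber (fun U => (⟦U.1.1.toModule⟧ : IsoClass k))]
  refine finsum_congr fun y => ?_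
  have hx (N : KroneckerModule k) : ⟦N⟧ = x ↔ N ≈ x.out := by
    conv_lhs => rw [← Quotient.out_eq x]
    exact Quotient.eq
  have hy (N : KroneckerModule k) : ⟦N⟧ = y ↔ N ≈ y.out := by
    conv_lhs => rw [← Quotient.out_eq y]
    exact Quotient.eq
  by_cases h : y.out.HasDim a b ∧ P x.out ∧ P y.out
  -- The innermost sum runs over proofs of a proposition: one term if it holds, none otherwise.
  · rw [finsum_eq_single _ h fun h' hne => (hne rfl).elim, hall]
    refine Nat.card_congr
      { toFun := fun U => ⟨⟨⟨U.1, h.1.of_equiv (Setoid.symm U.2.1),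
            hP (Setoid.symm U.2.2) h.2.1, hP (Setoid.symm U.2.1) h.2.2⟩,
            (hx _).2 U.2.2⟩, (hy _).2 U.2.1⟩
        invFun := fun U => ⟨U.1.1.1, (hy _).1 U.2, (hx _).1 U.1.2⟩
        left_inv := fun U => rfl
        right_inv := fun U => rfl }
  · have h0 (f : (y.out.HasDim a b ∧ P x.out ∧ P y.out) → ℕ) : ∑ᶠ i, f i = 0 := by
      have : IsEmpty (y.out.HasDim a b ∧ P x.out ∧ P y.out) := ⟨h⟩
      exact finsum_of_isEmpty f
    rw [h0, eq_comm]
    refine Nat.card_eq_zero.2 (Or.inl ⟨fun U => h ?_⟩)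
    have hUx := (hx _).1 U.1.2
    have hUy := (hy _).1 U.2
    exact ⟨U.1.1.2.1.of_equiv hUy, hP hUx U.1.1.2.2.1, hP hUy U.1.1.2.2.2⟩

theorem countB_eq_card {N : KroneckerModule k} (hN : N.NoS₁) (a b : ℤ) :
    countB N a b = Nat.card {U : Submodule k N.V₂ //
      (finrank k U : ℤ) = b ∧ (finrank k (N.gen U) : ℤ) = a} := by
  rw [countB, hallSum_eq_card NoS₁.of_equiv]
  exact Nat.card_congr
    { toFun := fun U => ⟨U.1.U₂, U.2.1.2, by
        rw [(noS₁_toModule_iff U.1).1 U.2.2.2]; exact U.2.1.1⟩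
      invFun := fun U => ⟨⟨N.gen U.1, U.1, fun _ => α_mem_gen, fun _ => β_mem_gen⟩,
        ⟨U.2.2, U.2.1⟩, hN.quotient _, (noS₁_toModule_iff _).2 rfl⟩
      left_inv := fun U => Subtype.ext (Sub.ext ((noS₁_toModule_iff U.1).1 U.2.2.2) rfl)
      right_inv := fun U => rfl }

theorem countC_eq_card {N : KroneckerModule k} (hN : N.NoS₂) (a b : ℤ) :
    countC N a b = Nat.card {U : Submodule k N.V₁ //
      (finrank k U : ℤ) = a ∧ (finrank k (N.cogen U) : ℤ) = b} := by
  rw [countC, hallSum_eq_card NoS₂.of_equiv]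
  exact Nat.card_congr
    { toFun := fun U => ⟨U.1.U₁, U.2.1.1, by
        rw [(noS₂_quotient_iff U.1).1 U.2.2.1]; exact U.2.1.2⟩
      invFun := fun U => ⟨⟨U.1, N.cogen U.1, fun _ h => h.1, fun _ h => h.2⟩,
        ⟨U.2.1, U.2.2⟩, (noS₂_quotient_iff _).2 rfl, hN.toModule _⟩
      left_inv := fun U => Subtype.ext (Sub.ext rfl ((noS₂_quotient_iff U.1).1 U.2.2.1))
      right_inv := fun U => rfl }

theorem countA_eq_finsum_gen (M : KroneckerModule k) (a b : ℤ) :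
    (Function.support fun c : ℤ => gaussCoeff (Nat.card k) c (finrank k M.V₁ - a + c) *
        (Nat.card {U : Submodule k M.V₂ //
          (finrank k U : ℤ) = b ∧ (finrank k (M.gen U) : ℤ) = a - c} : ℚ)).Finite ∧
      (countA M a b : ℚ) = ∑ᶠ c : ℤ, gaussCoeff (Nat.card k) c (finrank k M.V₁ - a + c) *
        (Nat.card {U : Submodule k M.V₂ //
          (finrank k U : ℤ) = b ∧ (finrank k (M.gen U) : ℤ) = a - c} : ℚ) := by
  have h := finsum_mul_card_fiber
    (fun U : {U : Submodule k M.V₂ // (finrank k U : ℤ) = b} => a - finrank k (M.gen U.1))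
    (fun c => gaussCoeff (Nat.card k) c (finrank k M.V₁ - a + c))
  have hcard (c : ℤ) : Nat.card {x : {U : Submodule k M.V₂ // (finrank k U : ℤ) = b} //
      a - (finrank k (M.gen x.1) : ℤ) = c} = Nat.card {U : Submodule k M.V₂ //
        (finrank k U : ℤ) = b ∧ (finrank k (M.gen U) : ℤ) = a - c} := by
    rw [Nat.card_congr (Equiv.subtypeSubtypeEquivSubtypeInter (fun U : Submodule k M.V₂ =>
      (finrank k U : ℤ) = b) fun U => a - (finrank k (M.gen U) : ℤ) = c)]
    exact Nat.card_congr (Equiv.subtypeEquivRight fun U => by lia)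
  simp only [hcard] at h
  refine ⟨h.1, Eq.trans ?_ h.2⟩
  have e : {U : Sub M // U.toModule.HasDim a b} ≃
      Σ U : {U : Submodule k M.V₂ // (finrank k U : ℤ) = b},
        {W : Submodule k M.V₁ // M.gen U.1 ≤ W ∧ (finrank k W : ℤ) = a} :=
    { toFun := fun U => ⟨⟨U.1.U₂, U.2.2⟩, ⟨U.1.U₁, gen_le_iff.2 ⟨U.1.map_α, U.1.map_β⟩, U.2.1⟩⟩
      invFun := fun U => ⟨⟨U.2.1, U.1.1, (gen_le_iff.1 U.2.2.1).1, (gen_le_iff.1 U.2.2.1).2⟩,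
        U.2.2.2, U.1.2⟩
      left_inv := fun U => rfl
      right_inv := fun U => rfl }
  have := Fintype.ofFinite {U : Submodule k M.V₂ // (finrank k U : ℤ) = b}
  rw [countA, Nat.card_congr e, Nat.card_sigma, Nat.cast_sum, finsum_eq_sum_of_fintype]
  refine Finset.sum_congr rfl fun U _ => ?_
  -- With `c = a - dim gen U`, the upper argument `dim V₁ - dim gen U` is `dim V₁ - a + c`.
  rw [card_finrank_submodule_ge]
  congr 1
  ring

theorem countA_eq_finsum_cogen (M : KroneckerModule k) (a b : ℤ) :
    (Function.support fun d : ℤ => gaussCoeff (Nat.card k) d (b + d) *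
        (Nat.card {U : Submodule k M.V₁ //
          (finrank k U : ℤ) = a ∧ (finrank k (M.cogen U) : ℤ) = b + d} : ℚ)).Finite ∧
      (countA M a b : ℚ) = ∑ᶠ d : ℤ, gaussCoeff (Nat.card k) d (b + d) *
        (Nat.card {U : Submodule k M.V₁ //
          (finrank k U : ℤ) = a ∧ (finrank k (M.cogen U) : ℤ) = b + d} : ℚ) := by
  have h := finsum_mul_card_fiber
    (fun U : {U : Submodule k M.V₁ // (finrank k U : ℤ) = a} => finrank k (M.cogen U.1) - b)
    (fun d => gaussCoeff (Nat.card k) d (b + d))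
  have hcard (d : ℤ) : Nat.card {x : {U : Submodule k M.V₁ // (finrank k U : ℤ) = a} //
      (finrank k (M.cogen x.1) : ℤ) - b = d} = Nat.card {U : Submodule k M.V₁ //
        (finrank k U : ℤ) = a ∧ (finrank k (M.cogen U) : ℤ) = b + d} := by
    rw [Nat.card_congr (Equiv.subtypeSubtypeEquivSubtypeInter (fun U : Submodule k M.V₁ =>
      (finrank k U : ℤ) = a) fun U => (finrank k (M.cogen U) : ℤ) - b = d)]
    exact Nat.card_congr (Equiv.subtypeEquivRight fun U => by lia)
  simp only [hcard] at h
  refine ⟨h.1, Eq.trans ?_ h.2⟩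
  have e : {U : Sub M // U.toModule.HasDim a b} ≃
      Σ U : {U : Submodule k M.V₁ // (finrank k U : ℤ) = a},
        {W : Submodule k M.V₂ // W ≤ M.cogen U.1 ∧ (finrank k W : ℤ) = b} :=
    { toFun := fun U => ⟨⟨U.1.U₁, U.2.1⟩, ⟨U.1.U₂, le_cogen_iff.2 ⟨U.1.map_α, U.1.map_β⟩, U.2.2⟩⟩
      invFun := fun U => ⟨⟨U.1.1, U.2.1, (le_cogen_iff.1 U.2.2.1).1, (le_cogen_iff.1 U.2.2.1).2⟩,
        U.1.2, U.2.2.2⟩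
      left_inv := fun U => rfl
      right_inv := fun U => rfl }
  have := Fintype.ofFinite {U : Submodule k M.V₁ // (finrank k U : ℤ) = a}
  have hq : (1 : ℚ) < Nat.card k := by exact_mod_cast Finite.one_lt_card
  rw [countA, Nat.card_congr e, Nat.card_sigma, Nat.cast_sum, finsum_eq_sum_of_fintype]
  refine Finset.sum_congr rfl fun U _ => ?_
  -- The direct count has lower index `b` inside dimension `b + d`; symmetry replaces `b` by `d`.
  rw [card_finrank_submodule_le, ← gaussCoeff_sub_self _ hq]
  congr 1
  ring

end Finite

/-! ### Reflections, and the effect of simple summands -/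

theorem finrank_submodule_prod {V W : Type*} [AddCommGroup V] [Module k V] [Module.Finite k V]
    [AddCommGroup W] [Module k W] [Module.Finite k W] (p : Submodule k V) (q : Submodule k W) :
    finrank k (p.prod q) = finrank k p + finrank k q := by
  have e : p.prod q ≃ₗ[k] p × q :=
    { toFun := fun x => (⟨x.1.1, x.2.1⟩, ⟨x.1.2, x.2.2⟩)
      invFun := fun x => ⟨(x.1, x.2), x.1.2, x.2.2⟩
      map_add' := fun _ _ => rfl
      map_smul' := fun _ _ => rfl }
  rw [e.finrank_eq, finrank_prod]

theorem finrank_map_of_injective {V W : Type*} [AddCommGroup V] [Module k V] [AddCommGroup W]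
    [Module k W] {f : V →ₗ[k] W} (hf : Function.Injective f) (p : Submodule k V) :
    finrank k (p.map f) = finrank k p :=
  (Submodule.equivMapOfInjective f hf p).finrank_eq.symm

theorem finrank_map_add_finrank_inf_ker {V W : Type*} [AddCommGroup V] [Module k V]
    [Module.Finite k V] [AddCommGroup W] [Module k W] (f : V →ₗ[k] W) (p : Submodule k V) :
    finrank k (p.map f) + finrank k (p ⊓ LinearMap.ker f : Submodule k V) = finrank k p := by
  have h := LinearMap.finrank_range_add_finrank_ker (f.domRestrict p)
  rwa [LinearMap.range_domRestrict, LinearMap.ker_domRestrict, ← Submodule.finrank_map_subtype_eq p,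
    Submodule.map_comap_subtype] at h

/-- The map `(α, β)` sends `U ⊕ U` onto `gen U`, and the kernel of this restriction is the `cogen`
of `U` in the reflected module. -/
theorem finrank_cogen_reflPlus (N : KroneckerModule k) (U : Submodule k N.V₂) :
    finrank k (N.gen U) + finrank k ((reflPlus N).cogen U) = 2 * finrank k U := by
  have h := finrank_map_add_finrank_inf_ker (N.α.coprod N.β) (U.prod U)
  have h1 : (U.prod U).map (N.α.coprod N.β) = N.gen U := LinearMap.map_coprod_prod _ _ _ _
  have h2 : (reflPlus N).cogen U =
    (U.prod U).comap (LinearMap.ker (N.α.coprod N.β)).subtype := rfl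
  have h3 : finrank k ((reflPlus N).cogen U) =
      finrank k (U.prod U ⊓ LinearMap.ker (N.α.coprod N.β) : Submodule k (N.V₂ × N.V₂)) := by
    rw [h2, inf_comm, ← Submodule.map_comap_subtype]
    exact (Submodule.finrank_map_subtype_eq _ _).symm
  rw [h1, ← h3, finrank_submodule_prod] at h
  lia

theorem noS₂_reflPlus (N : KroneckerModule k) : (reflPlus N).NoS₂ := by
  rw [noS₂_iff]
  exact eq_bot_iff.2 fun x hx => Subtype.ext (Prod.ext hx.1 hx.2)

theorem gen_reflMinus (N : KroneckerModule k) (U : Submodule k N.V₁) :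
    (reflMinus N).gen U =
      (U.prod U).map (LinearMap.range (N.α.prod N.β)).mkQ := by
  have h : (U.prod U : Submodule k (N.V₁ × N.V₁)) =
      U.map (LinearMap.inl k N.V₁ N.V₁) ⊔ U.map (LinearMap.inr k N.V₁ N.V₁) := by
    rw [← LinearMap.map_coprod_prod, LinearMap.coprod_inl_inr, Submodule.map_id]
  rw [h, Submodule.map_sup, ← Submodule.map_comp, ← Submodule.map_comp]
  rfl

/-- The quotient map sends `U ⊕ U` onto the new `gen U`, with kernel `(U ⊕ U) ∩ range (α, β)`.
Absence of `S₂` makes `V₂ → V₁ ⊕ V₁` injective, which identifies this kernel with `cogen U`. -/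
theorem finrank_gen_reflMinus {N : KroneckerModule k} (hN : N.NoS₂) (U : Submodule k N.V₁) :
    finrank k ((reflMinus N).gen U) + finrank k (N.cogen U) = 2 * finrank k U := by
  have h := finrank_map_add_finrank_inf_ker (LinearMap.range (N.α.prod N.β)).mkQ (U.prod U)
  have hinj : Function.Injective (N.α.prod N.β) := by
    rw [← LinearMap.ker_eq_bot, LinearMap.ker_prod]
    exact (noS₂_iff N).1 hN
  have h1 : finrank k (N.cogen U) =
      finrank k (U.prod U ⊓ LinearMap.range (N.α.prod N.β) : Submodule k (N.V₁ × N.V₁)) := by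
    rw [inf_comm, ← Submodule.map_comap_eq, finrank_map_of_injective hinj]
    rfl
  rw [Submodule.ker_mkQ, ← h1, finrank_submodule_prod, ← two_mul] at h
  rw [← h, gen_reflMinus]
  rfl

theorem noS₁_reflMinus (N : KroneckerModule k) : (reflMinus N).NoS₁ := by
  rw [noS₁_iff]
  refine (gen_reflMinus N ⊤).trans ?_
  rw [Submodule.prod_top, Submodule.map_top, Submodule.range_mkQ]
  rfl

theorem countC_reflPlus [Finite k] {N : KroneckerModule k} (hN : N.NoS₁) (a b : ℤ) :
    countC (reflPlus N) b (2 * b - a) = countB N a b := by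
  rw [countB_eq_card hN, countC_eq_card (noS₂_reflPlus N)]
  have h (U : Submodule k N.V₂) :
      (finrank k U : ℤ) = b ∧ (finrank k ((reflPlus N).cogen U) : ℤ) = 2 * b - a ↔
        (finrank k U : ℤ) = b ∧ (finrank k (N.gen U) : ℤ) = a := by
    have := finrank_cogen_reflPlus N U
    lia
  exact Nat.card_congr (Equiv.subtypeEquivRight h)

theorem countB_reflMinus [Finite k] {N : KroneckerModule k} (hN : N.NoS₂) (a b : ℤ) :
    countB (reflMinus N) (2 * a - b) a = countC N a b := by
  rw [countC_eq_card hN, countB_eq_card (noS₁_reflMinus N)]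
  have h (U : Submodule k N.V₁) :
      (finrank k U : ℤ) = a ∧ (finrank k ((reflMinus N).gen U) : ℤ) = 2 * a - b ↔
        (finrank k U : ℤ) = a ∧ (finrank k (N.cogen U) : ℤ) = b := by
    have := finrank_gen_reflMinus hN U
    lia
  exact Nat.card_congr (Equiv.subtypeEquivRight h)

/-- Enlarging `V₁` outside the image of the arrows does not change the counts of generated
subspaces. -/
theorem card_gen_congr {M N : KroneckerModule k} (e : M.V₂ ≃ₗ[k] N.V₂) (j : N.V₁ →ₗ[k] M.V₁)
    (hj : Function.Injective j) (hα : ∀ x, M.α x = j (N.α (e x)))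
    (hβ : ∀ x, M.β x = j (N.β (e x))) (w b : ℤ) :
    Nat.card {U : Submodule k M.V₂ // (finrank k U : ℤ) = b ∧ (finrank k (M.gen U) : ℤ) = w} =
      Nat.card {U : Submodule k N.V₂ //
        (finrank k U : ℤ) = b ∧ (finrank k (N.gen U) : ℤ) = w} := by
  refine Nat.card_congr ((Submodule.orderIsoMapComap e).toEquiv.subtypeEquiv fun U => ?_)
  have hα' : M.α = j ∘ₗ N.α ∘ₗ e.toLinearMap := LinearMap.ext hα
  have hβ' : M.β = j ∘ₗ N.β ∘ₗ e.toLinearMap := LinearMap.ext hβ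
  have hgen : M.gen U = (N.gen (U.map e.toLinearMap)).map j := by
    rw [gen, gen, hα', hβ', Submodule.map_sup]
    simp only [Submodule.map_comp]
  change _ ↔ (finrank k (U.map e.toLinearMap) : ℤ) = b ∧
    (finrank k (N.gen (U.map e.toLinearMap)) : ℤ) = w
  rw [hgen, finrank_map_of_injective hj, finrank_map_of_injective e.injective]

/-- Enlarging `V₂` by a subspace killed by the arrows shifts the counts of cogenerated
subspaces. -/
theorem card_cogen_congr {M N : KroneckerModule k} (e : M.V₁ ≃ₗ[k] N.V₁) (p : M.V₂ →ₗ[k] N.V₂)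
    (hp : Function.Surjective p) (hα : ∀ x, e (M.α x) = N.α (p x))
    (hβ : ∀ x, e (M.β x) = N.β (p x)) (a w : ℤ) :
    Nat.card {U : Submodule k M.V₁ //
        (finrank k U : ℤ) = a ∧ (finrank k (M.cogen U) : ℤ) = w} =
      Nat.card {U : Submodule k N.V₁ // (finrank k U : ℤ) = a ∧
        (finrank k (N.cogen U) : ℤ) = w - finrank k (LinearMap.ker p)} := by
  refine Nat.card_congr ((Submodule.orderIsoMapComap e).toEquiv.subtypeEquiv fun U => ?_)
  have hmem (x : M.V₁) : e x ∈ U.map e.toLinearMap ↔ x ∈ U :=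
    e.injective.mem_set_image
  have hcogen : M.cogen U = (N.cogen (U.map e.toLinearMap)).comap p := by
    ext x
    rw [Submodule.mem_comap, mem_cogen, mem_cogen, ← hα, ← hβ, hmem, hmem]
  change _ ↔ (finrank k (U.map e.toLinearMap) : ℤ) = a ∧
    (finrank k (N.cogen (U.map e.toLinearMap)) : ℤ) = _
  rw [hcogen, finrank_comap_of_surjective p hp, finrank_map_of_injective e.injective]
  lia

theorem NoS₁.sum_copies_simple₂ {N : KroneckerModule k} (hN : N.NoS₁) (t : ℕ) :
    (N.sum (copies t (simple₂ k))).NoS₁ := by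
  rw [noS₁_iff] at hN ⊢
  have hle : N.gen ⊤ ≤ ((N.sum (copies t (simple₂ k))).gen ⊤).comap (LinearMap.inl k N.V₁ _) :=
    gen_le_iff.2
      ⟨fun x _ => by
        have h := α_mem_gen (M := N.sum (copies t (simple₂ k))) (x := (x, 0)) (U := ⊤) trivial
        exact h,
      fun x _ => by
        have h := β_mem_gen (M := N.sum (copies t (simple₂ k))) (x := (x, 0)) (U := ⊤) trivial
        exact h⟩
  rw [hN] at hle
  -- The copies of `S₂` have zero space at vertex `1`, so `y` is definitionally `(y.1, 0)`.
  exact eq_top_iff.2 fun y _ => hle (x := y.1) trivial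

theorem NoS₂.copies_simple₁_sum {N : KroneckerModule k} (hN : N.NoS₂) (s : ℕ) :
    ((copies s (simple₁ k)).sum N).NoS₂ := by
  rw [noS₂_iff] at hN ⊢
  refine eq_bot_iff.2 fun x hx => Prod.ext rfl ?_
  have : x.2 ∈ N.cogen ⊥ := ⟨congrArg Prod.snd hx.1, congrArg Prod.snd hx.2⟩
  rwa [hN] at this

end KroneckerModule

/-! ### The proposition -/

open KroneckerModule in
theorem proposition3p1 {k : Type u} [Field k] [Finite k]
    (M M' : KroneckerModule k) (s t : ℕ)
    (hM : Nonempty (Iso M ((copies s (simple₁ k)).sum (M'.sum (copies t (simple₂ k))))))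
    (hM'₁ : M'.NoS₁) (hM'₂ : M'.NoS₂)
    (a b l m n : ℤ) (hl : l = a - b) (hdim : M.HasDim m n) :
    -- splitting off the copies of `S₁`
    ((Function.support fun c : ℤ =>
          gaussCoeff (Nat.card k) c (m - a + c) *
            (countB (M'.sum (copies t (simple₂ k))) (a - c) b : ℚ)).Finite ∧
      (countA M a b : ℚ) = ∑ᶠ c : ℤ,
          gaussCoeff (Nat.card k) c (m - a + c) *
            (countB (M'.sum (copies t (simple₂ k))) (a - c) b : ℚ) ∧
      (Function.support fun c : ℤ =>
          gaussCoeff (Nat.card k) c (m - a + c) *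
            (countC (reflPlus (M'.sum (copies t (simple₂ k)))) (a - l) (b - l + c) : ℚ)).Finite ∧
      (countA M a b : ℚ) = ∑ᶠ c : ℤ,
          gaussCoeff (Nat.card k) c (m - a + c) *
            (countC (reflPlus (M'.sum (copies t (simple₂ k)))) (a - l) (b - l + c) : ℚ)) ∧
    -- dually, splitting off the copies of `S₂`
    ((Function.support fun d : ℤ =>
          gaussCoeff (Nat.card k) d (b + d) *
            (countC ((copies s (simple₁ k)).sum M') a (b + d - t) : ℚ)).Finite ∧
      (countA M a b : ℚ) = ∑ᶠ d : ℤ,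
          gaussCoeff (Nat.card k) d (b + d) *
            (countC ((copies s (simple₁ k)).sum M') a (b + d - t) : ℚ) ∧
      (Function.support fun d : ℤ =>
          gaussCoeff (Nat.card k) d (b + d) *
            (countB (reflMinus ((copies s (simple₁ k)).sum M')) (a + l - d + t) (b + l) : ℚ)).Finite ∧
      (countA M a b : ℚ) = ∑ᶠ d : ℤ,
          gaussCoeff (Nat.card k) d (b + d) *
            (countB (reflMinus ((copies s (simple₁ k)).sum M')) (a + l - d + t) (b + l) : ℚ)) := by
  obtain ⟨e⟩ := hM
  rw [← hdim.1]
  constructor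
  · have hN : (M'.sum (copies t (simple₂ k))).NoS₁ := hM'₁.sum_copies_simple₂ t
    have hB (c : ℤ) : countB (M'.sum (copies t (simple₂ k))) (a - c) b =
        Nat.card {U : Submodule k M.V₂ //
          (Module.finrank k U : ℤ) = b ∧ (Module.finrank k (M.gen U) : ℤ) = a - c} := by
      rw [countB_eq_card hN]
      -- The copies of `S₁` add nothing at vertex `2`, and at vertex `1` only a complement that the
      -- arrows do not reach.
      refine (card_gen_congr (e.e₂.trans
        (LinearEquiv.uniqueProd (R := k) (M := M'.V₂ × (Fin t → k)) (M₂ := Fin s → PUnit.{u + 1})))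
        (e.e₁.symm.toLinearMap ∘ₗ LinearMap.inr k (Fin s → k) _)
        (e.e₁.symm.injective.comp LinearMap.inr_injective) (fun x => ?_) (fun x => ?_) _ _).symm
      · exact (e.e₁.eq_symm_apply).2 (e.comm_α x)
      · exact (e.e₁.eq_symm_apply).2 (e.comm_β x)
    have hC (c : ℤ) : countC (reflPlus (M'.sum (copies t (simple₂ k)))) (a - l) (b - l + c) =
        countB (M'.sum (copies t (simple₂ k))) (a - c) b := by
      -- Since `l = a - b`, the indices are `a - l = b` and `b - l + c = 2b - (a - c)`.
      rw [← countC_reflPlus hN, hl]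
      congr 1 <;> ring
    have h := countA_eq_finsum_gen M a b
    simp only [hC, hB]
    exact ⟨h.1, h.2, h⟩
  · have hN : ((copies s (simple₁ k)).sum M').NoS₂ := hM'₂.copies_simple₁_sum s
    have hC (d : ℤ) : countC ((copies s (simple₁ k)).sum M') a (b + d - t) =
        Nat.card {U : Submodule k M.V₁ //
          (Module.finrank k U : ℤ) = a ∧ (Module.finrank k (M.cogen U) : ℤ) = b + d} := by
      -- This projection forgets the copies of `S₂`; its kernel has dimension `t`, the source of the
      -- shift by `-t`.
      let p : M.V₂ →ₗ[k] (Fin s → PUnit.{u + 1}) × M'.V₂ :=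
        (LinearMap.id.prodMap (LinearMap.fst k M'.V₂ (Fin t → k))) ∘ₗ e.e₂.toLinearMap
      have hp : Function.Surjective p :=
        (Function.surjective_id.prodMap Prod.fst_surjective).comp e.e₂.surjective
      have hker : Module.finrank k (LinearMap.ker p) = t := by
        have h1 := LinearMap.finrank_range_add_finrank_ker p
        rw [LinearMap.range_eq_top.2 hp, finrank_top, e.e₂.finrank_eq] at h1
        -- The spaces are restated as explicit products so that `Module.finrank_prod` can rewrite
        -- them.
        have h2 : Module.finrank k ((Fin s → PUnit.{u + 1}) × M'.V₂) +
            Module.finrank k (LinearMap.ker p) =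
              Module.finrank k ((Fin s → PUnit.{u + 1}) × (M'.V₂ × (Fin t → k))) := h1
        rw [Module.finrank_prod, Module.finrank_prod, Module.finrank_prod,
          Module.finrank_fin_fun] at h2
        lia
      rw [countC_eq_card hN, ← hker]
      refine (card_cogen_congr (N := (copies s (simple₁ k)).sum M')
        (e.e₁.trans ((LinearEquiv.refl k (Fin s → k)).prodCongr
          (LinearEquiv.prodUnique (M := M'.V₁) (M₂ := Fin t → PUnit.{u + 1})))) p hp
        (fun x => ?_) (fun x => ?_) _ _).symm
      · exact congrArg (fun y : (Fin s → k) × (M'.V₁ × (Fin t → PUnit.{u + 1})) => (y.1, y.2.1))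
          (e.comm_α x)
      · exact congrArg (fun y : (Fin s → k) × (M'.V₁ × (Fin t → PUnit.{u + 1})) => (y.1, y.2.1))
          (e.comm_β x)
    have hB (d : ℤ) : countB (reflMinus ((copies s (simple₁ k)).sum M')) (a + l - d + t) (b + l) =
        countC ((copies s (simple₁ k)).sum M') a (b + d - t) := by
      -- Here `b + l = a` and `a + l - d + t = 2a - (b + d - t)`.
      rw [← countB_reflMinus hN, hl]
      congr 1 <;> ring
    have h := countA_eq_finsum_cogen M a b
    simp only [hB, hC]
    exact ⟨h.1, h.2, h⟩
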